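/- Graphs are finite, simple and undirected. A set $F$ of vertices of a graph $G$ is a dissociation set if the induced subgraph $G[F]$ has maximum degree at most $1$, and it is a maximal dissociation set if moreover it is not a proper subset of any other dissociation set. Let $\phi(G)$ denote the number of maximal dissociation sets of $G$. Let $C_4$ be the cycle on four vertices, and let $\ell C_4$ denote the disjoint union of $\ell$ copies of $C_4$ (the graph without vertices if $\ell = 0$). Let $G$ be a bipartite graph of order $n$. Then $\phi(G) \le 6^{n/4}$. Furthermore, $\phi(G) = 6^{n/4}$ if and only if $n \equiv 0 \pmod 4$ and $G \cong \frac{n}{4} C_4$. -/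

import Mathlib

namespace SimpleGraph

/-- A set of vertices `F` is a dissociation set of `G` if the induced subgraph `G[F]` has
maximum degree at most `1`: every vertex of `G[F]` has at most one neighbour in `G[F]`. -/
def IsDissociationSet {V : Type*} (G : SimpleGraph V) (F : Set V) : Prop :=
  ∀ v : F, ((G.induce F).neighborSet v).encard ≤ 1

/-- A dissociation set that is not a proper subset of any other dissociation set. -/
def IsMaximalDissociationSet {V : Type*} (G : SimpleGraph V) (F : Set V) : Prop :=
  G.IsDissociationSet F ∧ ∀ F' : Set V, G.IsDissociationSet F' → ¬ F ⊂ F'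

/-- The number of maximal dissociation sets of `G`. -/
noncomputable def numMaximalDissociationSets {V : Type*} (G : SimpleGraph V) : ℕ :=
  {F : Set V | G.IsMaximalDissociationSet F}.ncard

/-- The disjoint union of `l` copies of the graph `H`: the vertex `(i, v)` is the vertex `v` of
the `i`-th copy, and adjacency holds only inside a copy. -/
def copies {W : Type*} (l : ℕ) (H : SimpleGraph W) : SimpleGraph (Fin l × W) where
  Adj x y := x.1 = y.1 ∧ H.Adj x.2 y.2
  symm := ⟨fun _ _ h => ⟨h.1.symm, h.2.symm⟩⟩
  loopless := ⟨fun _ h => H.loopless.irrefl _ h.2⟩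

end SimpleGraph

set_option linter.unusedSectionVars false

/-! Write τ = 6^(-1/4) and normalise the number of maximal dissociation sets of G[X] to
`dissocRatio` = count · τ^|X|. The bound says that this ratio never exceeds 1, and it is proved for
all vertex subsets X by strong induction.

The engine is branching. Classify a maximal set F by its trace S = F ∩ D on a set D containing all
X-neighbours of S. Then F \ D is maximal in X \ D and determines F, so this class contributes at
most τ^|D| times the ratio of X \ D (`dissocRatio_le_sum`). Bipartiteness enters only as
triangle-freeness: adjacent vertices have disjoint neighbourhoods, so a branch fixing an edge uv of
G[F] deletes d(u) + d(v) vertices.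

A vertex of degree at most one pushes the ratio down to about 0.836. If all degrees are at least
two, deleting a vertex creates leaves next to it, and the resulting savings give a ratio below 1
when there is a vertex of degree at least three, or when the graph is 2-regular and a chosen vertex
is not on a four-cycle. On a four-cycle component F has exactly two vertices, six choices in all,
and 6τ⁴ = 1, so the component can be removed without lowering the ratio. Hence a nonempty X has
ratio below 1 or splits off a four-cycle (`dissocRatio_lt_one_or`); peeling these off yields both
the bound and the equality case. Conversely, choosing a pair in each of k four-cycles gives 6^k
maximal sets (`pow_le_card_maxDissocIn`). -/

namespace SimpleGraph

open Finset

variable {V : Type*} [DecidableEq V] {G : SimpleGraph V} {X D S F : Finset V} {u v w x y : V}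

/-! ### Maximal dissociation sets of induced subgraphs and their restrictions -/

/-- `F` is a finite dissociation set: no vertex of `F` has two distinct neighbours in `F`. -/
def IsDissoc (G : SimpleGraph V) (F : Finset V) : Prop :=
  ∀ a ∈ F, ∀ b ∈ F, ∀ c ∈ F, G.Adj a b → G.Adj a c → b = c

/-- `F` is a maximal dissociation set of the subgraph of `G` induced on `X`. -/
def IsMaxDissocIn (G : SimpleGraph V) (X F : Finset V) : Prop :=
  F ⊆ X ∧ G.IsDissoc F ∧ ∀ x ∈ X, x ∉ F → ¬ G.IsDissoc (insert x F)

open Classical in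
/-- The maximal dissociation sets of the subgraph of `G` induced on `X`. -/
noncomputable def maxDissocIn (G : SimpleGraph V) (X : Finset V) : Finset (Finset V) :=
  X.powerset.filter (G.IsMaxDissocIn X)

open Classical in
/-- The neighbours of `v` in `X`. -/
noncomputable def nbr (G : SimpleGraph V) (X : Finset V) (v : V) : Finset V :=
  X.filter (G.Adj v)

lemma mem_maxDissocIn : F ∈ G.maxDissocIn X ↔ G.IsMaxDissocIn X F := by
  simp only [maxDissocIn, mem_filter, mem_powerset, and_iff_right_iff_imp]
  exact fun h => h.1

lemma mem_nbr : u ∈ G.nbr X v ↔ u ∈ X ∧ G.Adj v u := by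
  simp [nbr]

lemma nbr_subset : G.nbr X v ⊆ X := fun _ h => (mem_nbr.1 h).1

lemma nbr_sdiff : G.nbr (X \ D) v = G.nbr X v \ D := by
  ext a; simp only [mem_nbr, mem_sdiff]; tauto

lemma IsDissoc.mono (h : G.IsDissoc F) (hS : S ⊆ F) : G.IsDissoc S :=
  fun a ha b hb c hc => h a (hS ha) b (hS hb) c (hS hc)

/-- Adding a vertex none of whose neighbours lies in the set keeps a dissociation set. -/
lemma IsDissoc.insert_of_forall_not_adj (h : G.IsDissoc F) (hx : ∀ a ∈ F, ¬ G.Adj x a) :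
    G.IsDissoc (insert x F) := by
  intro a ha b hb c hc hab hac
  have hx' : ∀ a ∈ F, ¬ G.Adj a x := fun a ha h => hx a ha h.symm
  rw [mem_insert] at ha hb hc
  have := G.loopless.irrefl x
  rcases ha with rfl | ha <;> rcases hb with rfl | hb <;> rcases hc with rfl | hc <;>
    grind [IsDissoc]

/-- Since the neighbours of `S` stay in `D`, the two pieces of `F` inside and outside `D` do not
interact; a vertex that could extend the outer piece could already extend `F`. -/
lemma IsMaxDissocIn.sdiff (h : G.IsMaxDissocIn X F) (hS : F ∩ D = S)
    (hN : ∀ s ∈ S, G.nbr X s ⊆ D) : G.IsMaxDissocIn (X \ D) (F \ D) := by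
  obtain ⟨hFX, hF, hmax⟩ := h
  refine ⟨sdiff_subset_sdiff hFX le_rfl, hF.mono sdiff_subset, ?_⟩
  intro x hx hxF hd
  rw [mem_sdiff] at hx hxF
  have hxF' : x ∉ F := fun h => hxF ⟨h, hx.2⟩
  refine hmax x hx.1 hxF' ?_
  -- No edge within `insert x F` leaves `D`, so the degree condition can be checked on each side
  -- separately.
  have key : ∀ a ∈ insert x F, ∀ b ∈ insert x F, G.Adj a b → a ∈ D → b ∈ D := by
    intro a ha b hb hab haD
    have haF : a ∈ F := by
      rcases mem_insert.1 ha with rfl | h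
      · exact absurd haD hx.2
      · exact h
    have hbX : b ∈ X := by
      rcases mem_insert.1 hb with rfl | h
      · exact hx.1
      · exact hFX h
    exact hN a (hS ▸ mem_inter.2 ⟨haF, haD⟩) (mem_nbr.2 ⟨hbX, hab⟩)
  intro a ha b hb c hc hab hac
  by_cases haD : a ∈ D
  · have hbD := key a ha b hb hab haD
    have hcD := key a ha c hc hac haD
    refine hF a ?_ b ?_ c ?_ hab hac <;> grind
  · have hbD : b ∉ D := fun h => haD (key b hb a ha hab.symm h)
    have hcD : c ∉ D := fun h => haD (key c hc a ha hac.symm h)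
    refine hd a ?_ b ?_ c ?_ hab hac <;> grind

/-- The number of maximal dissociation sets of `G[X]` meeting `D` exactly in `S` is at most the
number of maximal dissociation sets of `G[X \ D]`, when `D` contains the neighbours of `S`. -/
lemma card_filter_inter_eq_le (hN : ∀ s ∈ S, G.nbr X s ⊆ D) :
    #{F ∈ G.maxDissocIn X | F ∩ D = S} ≤ #(G.maxDissocIn (X \ D)) := by
  refine card_le_card_of_injOn (fun F => F \ D) ?_ ?_
  · intro F hF
    have hF := mem_filter.1 hF
    exact mem_maxDissocIn.2 ((mem_maxDissocIn.1 hF.1).sdiff hF.2 hN)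
  · intro F hF F' hF' h
    have hF := (mem_filter.1 hF).2
    have hF' := (mem_filter.1 hF').2
    dsimp only at h
    rw [← sdiff_union_inter F D, ← sdiff_union_inter F' D, h, hF, hF']

/-! ### Numerical estimates for τ -/

/-- The inverse of the extremal growth rate. -/
noncomputable def invRate : ℝ := (6 : ℝ) ^ (-(1 / 4) : ℝ)

local notation "τ" => invRate

lemma invRate_pos : 0 < τ := by unfold invRate; positivity

lemma invRate_pow_four : τ ^ 4 = 1 / 6 := by
  unfold invRate
  rw [← Real.rpow_natCast, ← Real.rpow_mul (by norm_num)]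
  norm_num [Real.rpow_neg_one]

lemma invRate_lt : τ < 0.638944 := by
  by_contra! h
  have := pow_le_pow_left₀ (by norm_num) h 4
  rw [invRate_pow_four] at this
  norm_num at this

lemma invRate_gt : 0.6389 < τ := by
  by_contra! h
  have := pow_le_pow_left₀ invRate_pos.le h 4
  rw [invRate_pow_four] at this
  norm_num at this

lemma invRate_sq_lt : τ ^ 2 < 0.40825 := by
  have := pow_lt_pow_left₀ invRate_lt invRate_pos.le (n := 2) (by norm_num)
  norm_num at this ⊢; linarith

lemma invRate_sq_gt : 0.4081 < τ ^ 2 := by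
  have := pow_lt_pow_left₀ invRate_gt (by norm_num) (n := 2) (by norm_num)
  norm_num at this ⊢; linarith

lemma invRate_cube_lt : τ ^ 3 < 0.26085 := by
  have := pow_lt_pow_left₀ invRate_lt invRate_pos.le (n := 3) (by norm_num)
  norm_num at this ⊢; linarith

lemma invRate_cube_gt : 0.2607 < τ ^ 3 := by
  have := pow_lt_pow_left₀ invRate_gt (by norm_num) (n := 3) (by norm_num)
  norm_num at this ⊢; linarith

lemma invRate_pow_five : τ ^ 5 = τ / 6 := by
  rw [pow_succ, invRate_pow_four]; ring

lemma invRate_pow_six : τ ^ 6 = τ ^ 2 / 6 := by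
  rw [show 6 = 4 + 2 from rfl, pow_add, invRate_pow_four]; ring

lemma invRate_pow_seven : τ ^ 7 = τ ^ 3 / 6 := by
  rw [show 7 = 4 + 3 from rfl, pow_add, invRate_pow_four]; ring

lemma invRate_pow_le_pow {m n : ℕ} (h : m ≤ n) : τ ^ n ≤ τ ^ m :=
  pow_le_pow_of_le_one invRate_pos.le (by linarith [invRate_lt]) h

/-! ### The normalised count and branching inequalities -/

/-- The number of maximal dissociation sets of `G[X]`, divided by `6 ^ (|X| / 4)`. -/
noncomputable def dissocRatio (G : SimpleGraph V) (X : Finset V) : ℝ :=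
  #(G.maxDissocIn X) * τ ^ #X

lemma dissocRatio_nonneg : 0 ≤ G.dissocRatio X :=
  mul_nonneg (Nat.cast_nonneg _) (pow_nonneg invRate_pos.le _)

lemma card_filter_mul_le (hD : D ⊆ X) (hN : ∀ s ∈ S, G.nbr X s ⊆ D) :
    (#{F ∈ G.maxDissocIn X | F ∩ D = S} : ℝ) * τ ^ #X ≤
      τ ^ #D * G.dissocRatio (X \ D) := by
  have h1 : #X = #D + #(X \ D) := by rw [card_sdiff_of_subset hD]; have := card_le_card hD; omega
  have h2 : (#{F ∈ G.maxDissocIn X | F ∩ D = S} : ℝ) ≤ #(G.maxDissocIn (X \ D)) := by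
    exact_mod_cast card_filter_inter_eq_le hN
  rw [dissocRatio, h1, pow_add]
  have := invRate_pos
  calc _ ≤ (#(G.maxDissocIn (X \ D)) : ℝ) * (τ ^ #D * τ ^ #(X \ D)) := by gcongr
    _ = _ := by ring

/-- Branching: if every maximal dissociation set of `G[X]` meets some `D i` in exactly `S i`. -/
lemma dissocRatio_le_sum {ι : Type*} (I : Finset ι) (D S : ι → Finset V)
    (hD : ∀ i ∈ I, D i ⊆ X) (hN : ∀ i ∈ I, ∀ s ∈ S i, G.nbr X s ⊆ D i)
    (hcov : ∀ F, G.IsMaxDissocIn X F → ∃ i ∈ I, F ∩ D i = S i) :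
    G.dissocRatio X ≤ ∑ i ∈ I, τ ^ #(D i) * G.dissocRatio (X \ D i) := by
  have h1 : G.maxDissocIn X ⊆ I.biUnion fun i => {F ∈ G.maxDissocIn X | F ∩ D i = S i} := by
    intro F hF
    obtain ⟨i, hi, h⟩ := hcov F (mem_maxDissocIn.1 hF)
    exact mem_biUnion.2 ⟨i, hi, mem_filter.2 ⟨hF, h⟩⟩
  have h2 : (#(G.maxDissocIn X) : ℝ) ≤ ∑ i ∈ I, (#{F ∈ G.maxDissocIn X | F ∩ D i = S i} : ℝ) := by
    exact_mod_cast (card_le_card h1).trans card_biUnion_le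
  have := invRate_pos
  calc G.dissocRatio X ≤ (∑ i ∈ I, (#{F ∈ G.maxDissocIn X | F ∩ D i = S i} : ℝ)) * τ ^ #X := by
        unfold dissocRatio; gcongr
    _ = ∑ i ∈ I, (#{F ∈ G.maxDissocIn X | F ∩ D i = S i} : ℝ) * τ ^ #X := sum_mul ..
    _ ≤ _ := sum_le_sum fun i hi => card_filter_mul_le (hD i hi) (hN i hi)

/-- No three vertices are pairwise adjacent. -/
def TriangleFree (G : SimpleGraph V) : Prop := ∀ a b c, G.Adj a b → G.Adj b c → ¬ G.Adj a c

lemma TriangleFree.card_nbr_union (hG : G.TriangleFree) (h : G.Adj u v) :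
    #(G.nbr X u ∪ G.nbr X v) = #(G.nbr X u) + #(G.nbr X v) := by
  refine card_union_of_disjoint (Finset.disjoint_left.2 fun a ha hb => ?_)
  exact hG u v a h (mem_nbr.1 hb).2 (mem_nbr.1 ha).2

/-- Each end of an edge inside `F` has the other end as its only neighbour in `F`. This identifies
the trace in the branches that fix an edge. -/
lemma IsDissoc.inter_nbr_union (hF : G.IsDissoc F) (hFX : F ⊆ X) (hu : u ∈ F) (hv : v ∈ F)
    (h : G.Adj u v) : F ∩ (G.nbr X u ∪ G.nbr X v) = {u, v} := by
  ext a
  simp only [mem_inter, mem_union, mem_nbr, mem_insert, mem_singleton]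
  constructor
  · rintro ⟨ha, h1 | h1⟩
    · exact Or.inr (hF u hu a ha v hv h1.2 h)
    · exact Or.inl (hF v hv a ha u hu h1.2 h.symm)
  · rintro (rfl | rfl)
    · exact ⟨hu, Or.inr ⟨hFX hu, h.symm⟩⟩
    · exact ⟨hv, Or.inl ⟨hFX hv, h⟩⟩

/-- An isolated vertex of `G[X]` lies in every maximal dissociation set. -/
lemma dissocRatio_le_of_nbr_eq_empty (hx : x ∈ X) (h : G.nbr X x = ∅) :
    G.dissocRatio X ≤ τ * G.dissocRatio (X \ {x}) := by
  refine (dissocRatio_le_sum {()} (fun _ => {x}) (fun _ => {x}) ?_ ?_ ?_).trans ?_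
  · simpa using hx
  · simp [h]
  · intro F hF
    refine ⟨(), by simp, inter_eq_right.2 (singleton_subset_iff.2 ?_)⟩
    by_contra hxF
    refine hF.2.2 x hx hxF (hF.2.1.insert_of_forall_not_adj fun a ha hxa => ?_)
    have : a ∈ G.nbr X x := mem_nbr.2 ⟨hF.1 ha, hxa⟩
    simp [h] at this
  · simp

/-- Branching at a vertex `x` of degree one with neighbour `y`. -/
lemma TriangleFree.dissocRatio_le_of_leaf (hG : G.TriangleFree) (hx : x ∈ X)
    (h : G.nbr X x = {y}) :
    G.dissocRatio X ≤ τ ^ 2 * G.dissocRatio (X \ {x, y}) +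
      ∑ w ∈ G.nbr X y, τ ^ (#(G.nbr X y) + #(G.nbr X w)) *
        G.dissocRatio (X \ (G.nbr X y ∪ G.nbr X w)) := by
  have hy : y ∈ X ∧ G.Adj x y := mem_nbr.1 (h ▸ mem_singleton_self y)
  have hne : x ≠ y := hy.2.ne
  refine (dissocRatio_le_sum (insertNone (G.nbr X y))
    (fun o => o.elim {x, y} fun w => G.nbr X y ∪ G.nbr X w)
    (fun o => o.elim {x} fun w => {y, w}) ?_ ?_ ?_).trans ?_
  · rw [forall_mem_insertNone]
    refine ⟨by simp [insert_subset_iff, hx, hy.1], fun w _ => union_subset nbr_subset nbr_subset⟩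
  · rw [forall_mem_insertNone]
    refine ⟨by simp [h], fun w _ => by simp⟩
  · intro F hF
    have hnb : ∀ a ∈ F, G.Adj x a → a = y := fun a ha hxa => by
      have : a ∈ G.nbr X x := mem_nbr.2 ⟨hF.1 ha, hxa⟩
      simpa [h] using this
    by_cases hyF : y ∈ F
    · obtain ⟨w, hw, hyw⟩ : ∃ w ∈ F, G.Adj y w := by
        by_contra! hno
        refine hF.2.2 x hx (fun hxF => hno x hxF hy.2.symm) ?_
        intro a ha b hb c hc hab hac
        rw [mem_insert] at ha hb hc
        have := G.loopless.irrefl x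
        have := hF.2.1
        have := fun a ha hxa => hnb a ha (G.symm.symm _ _ hxa)
        rcases ha with rfl | ha <;> rcases hb with rfl | hb <;> rcases hc with rfl | hc <;>
          grind [IsDissoc]
      refine ⟨some w, ?_, hF.2.1.inter_nbr_union hF.1 hyF hw hyw⟩
      simpa using mem_nbr.2 ⟨hF.1 hw, hyw⟩
    · refine ⟨none, by simp, ?_⟩
      have hxF : x ∈ F := by
        by_contra hxF
        exact hF.2.2 x hx hxF (hF.2.1.insert_of_forall_not_adj
          fun a ha hxa => hyF (hnb a ha hxa ▸ ha))
      ext a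
      simp only [Option.elim, mem_inter, mem_insert, mem_singleton]
      constructor
      · rintro ⟨ha, rfl | rfl⟩
        · rfl
        · exact absurd ha hyF
      · rintro rfl
        exact ⟨hxF, Or.inl rfl⟩
  · rw [sum_insertNone]
    refine add_le_add (le_of_eq ?_) (sum_le_sum fun w hw => le_of_eq ?_)
    · simp [card_pair hne]
    · simp [hG.card_nbr_union (mem_nbr.1 hw).2]

/-- Branching at an arbitrary vertex `v`. -/
lemma TriangleFree.dissocRatio_le (hG : G.TriangleFree) (hv : v ∈ X) :
    G.dissocRatio X ≤ τ * G.dissocRatio (X \ {v}) +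
      τ ^ (#(G.nbr X v) + 1) * G.dissocRatio (X \ insert v (G.nbr X v)) +
      ∑ u ∈ G.nbr X v, τ ^ (#(G.nbr X v) + #(G.nbr X u)) *
        G.dissocRatio (X \ (G.nbr X v ∪ G.nbr X u)) := by
  refine (dissocRatio_le_sum (insertNone (insertNone (G.nbr X v)))
    (fun o => o.elim {v} fun o => o.elim (insert v (G.nbr X v)) fun w => G.nbr X v ∪ G.nbr X w)
    (fun o => o.elim ∅ fun o => o.elim {v} fun w => {v, w}) ?_ ?_ ?_).trans ?_
  · rw [forall_mem_insertNone, forall_mem_insertNone]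
    exact ⟨by simpa using hv, insert_subset hv nbr_subset,
      fun w _ => union_subset nbr_subset nbr_subset⟩
  · rw [forall_mem_insertNone, forall_mem_insertNone]
    exact ⟨by simp, by simp, fun w _ => by simp⟩
  · intro F hF
    by_cases hvF : v ∈ F
    · by_cases hw : ∃ w ∈ F, G.Adj v w
      · obtain ⟨w, hw, hvw⟩ := hw
        refine ⟨some (some w), ?_, hF.2.1.inter_nbr_union hF.1 hvF hw hvw⟩
        simpa using mem_nbr.2 ⟨hF.1 hw, hvw⟩
      · push Not at hw
        refine ⟨some none, by simp, ?_⟩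
        ext a
        simp only [Option.elim, mem_inter, mem_insert, mem_singleton, mem_nbr]
        constructor
        · rintro ⟨ha, rfl | h⟩
          · rfl
          · exact absurd h.2 (hw a ha)
        · rintro rfl
          exact ⟨hvF, Or.inl rfl⟩
    · exact ⟨none, by simp, inter_singleton_of_notMem hvF⟩
  · rw [sum_insertNone, sum_insertNone, ← add_assoc]
    have : v ∉ G.nbr X v := fun h => (mem_nbr.1 h).2.ne rfl
    refine add_le_add (add_le_add (le_of_eq ?_) (le_of_eq ?_)) (sum_le_sum fun w hw => le_of_eq ?_)
    · simp
    · simp [card_insert_of_notMem this]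
    · simp [hG.card_nbr_union (mem_nbr.1 hw).2]

/-! ### Savings from vertices of degree at most one -/

/-- The bound on the number of maximal dissociation sets holds for all proper subsets of `X`. -/
def BoundBelow (G : SimpleGraph V) (X : Finset V) : Prop := ∀ Y, Y ⊂ X → G.dissocRatio Y ≤ 1

lemma BoundBelow.sdiff (h : G.BoundBelow X) : G.BoundBelow (X \ D) :=
  fun Y hY => h Y (hY.trans_subset sdiff_subset)

lemma BoundBelow.ratio_le_one (h : G.BoundBelow X) (hx : x ∈ X) (hD : x ∈ D) :
    G.dissocRatio (X \ D) ≤ 1 :=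
  h _ ⟨sdiff_subset, fun hs => (mem_sdiff.1 (hs hx)).2 hD⟩

lemma invRate_pow_mul_le {m n : ℕ} {r : ℝ} (h : m ≤ n) (hr : r ≤ 1) : τ ^ n * r ≤ τ ^ m :=
  (mul_le_of_le_one_right (pow_nonneg invRate_pos.le _) hr).trans (invRate_pow_le_pow h)

/-- The sequence d · τ^(d+1) decreases from d = 2 on, because (d+1)τ ≤ d there; large degrees thus
reduce to the smallest one allowed. -/
lemma natCast_mul_invRate_pow_le {k d : ℕ} (hk : 2 ≤ k) (h : k ≤ d) :
    (d : ℝ) * τ ^ (d + 1) ≤ k * τ ^ (k + 1) := by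
  induction d, h using Nat.le_induction with
  | base => rfl
  | succ d hd ih =>
    refine le_trans ?_ ih
    have h2 : (2 : ℝ) ≤ d := by exact_mod_cast hk.trans hd
    have h3 : ((d : ℝ) + 1) * τ ≤ d := by nlinarith [invRate_lt]
    have := pow_pos invRate_pos (d + 1)
    rw [pow_succ τ (d + 1)]
    push_cast
    nlinarith

lemma one_le_card_nbr (hy : y ∈ X) (hw : w ∈ G.nbr X y) : 1 ≤ #(G.nbr X w) :=
  card_pos.2 ⟨y, mem_nbr.2 ⟨hy, (mem_nbr.1 hw).2.symm⟩⟩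

lemma nbr_eq_singleton (hy : y ∈ X) (hw : w ∈ G.nbr X y) (h : #(G.nbr X w) ≤ 1) :
    G.nbr X w = {y} := by
  have hyw : y ∈ G.nbr X w := mem_nbr.2 ⟨hy, (mem_nbr.1 hw).2.symm⟩
  exact (eq_singleton_iff_unique_mem).2 ⟨hyw, fun a ha => card_le_one.1 h a ha y hyw⟩

/-- Two leaves with the same neighbour. -/
lemma TriangleFree.dissocRatio_le_of_twins (hG : G.TriangleFree) (hX : G.BoundBelow X)
    {x' : V} (hx : x ∈ X) (hx' : x' ∈ X) (hne : x ≠ x') (h : G.nbr X x = {y})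
    (h' : G.nbr X x' = {y}) :
    2 ≤ #(G.nbr X y) ∧
      G.dissocRatio X ≤ τ ^ 3 + #(G.nbr X y) * τ ^ (#(G.nbr X y) + 1) := by
  have hy : y ∈ X ∧ G.Adj x y := mem_nbr.1 (h ▸ mem_singleton_self y)
  have hy' : y ∈ X ∧ G.Adj x' y := mem_nbr.1 (h' ▸ mem_singleton_self y)
  constructor
  · rw [← card_pair hne]
    refine card_le_card ?_
    simp [insert_subset_iff, mem_nbr, hx, hx', hy.2.symm, hy'.2.symm]
  refine (hG.dissocRatio_le_of_leaf hx h).trans (add_le_add ?_ ?_)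
  -- With `y` gone the twin `x'` is isolated, which gains a third factor τ.
  · have hx2 : x' ∈ X \ {x, y} := by simp [hx', hne.symm, hy'.2.ne]
    have h1 := dissocRatio_le_of_nbr_eq_empty hx2 (G := G) (by simp [nbr_sdiff, h'])
    have h2 := hX.sdiff.ratio_le_one hx2 (mem_singleton_self x')
    calc _ ≤ τ ^ 2 * (τ * 1) := by
          have := invRate_pos
          gcongr
          exact h1.trans (by gcongr)
      _ = τ ^ 3 := by ring
  · rw [← nsmul_eq_mul]
    refine sum_le_card_nsmul _ _ _ fun w hw => invRate_pow_mul_le ?_ ?_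
    · have := one_le_card_nbr hy.1 hw
      omega
    · exact hX.ratio_le_one hx (mem_union_left _ (mem_nbr.2 ⟨hx, hy.2.symm⟩))

/-- A leaf whose neighbour `y` has no other leaf. -/
lemma TriangleFree.dissocRatio_le_of_single_leaf (hG : G.TriangleFree) (hX : G.BoundBelow X)
    (hx : x ∈ X) (h : G.nbr X x = {y}) (hno : ∀ w ∈ G.nbr X y, w ≠ x → 2 ≤ #(G.nbr X w))
    {e : ℕ} (he : #(G.nbr X y) = e + 1) :
    G.dissocRatio X ≤ τ ^ 2 * G.dissocRatio (X \ {x, y}) + (τ ^ (e + 2) + e * τ ^ (e + 3)) := by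
  have hy : y ∈ X ∧ G.Adj x y := mem_nbr.1 (h ▸ mem_singleton_self y)
  have hxy : x ∈ G.nbr X y := mem_nbr.2 ⟨hx, hy.2.symm⟩
  refine (hG.dissocRatio_le_of_leaf hx h).trans (add_le_add le_rfl ?_)
  rw [← add_sum_erase _ _ hxy]
  have hle : ∀ w, G.dissocRatio (X \ (G.nbr X y ∪ G.nbr X w)) ≤ 1 := fun w =>
    hX.ratio_le_one hx (mem_union_left _ hxy)
  refine add_le_add (invRate_pow_mul_le (by simp [h, he]) (hle x)) ?_
  have hc : #((G.nbr X y).erase x) = e := by rw [card_erase_of_mem hxy, he]; rfl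
  rw [show (e : ℝ) * τ ^ (e + 3) = #((G.nbr X y).erase x) • τ ^ (e + 3) by
    rw [hc, nsmul_eq_mul]]
  refine sum_le_card_nsmul _ _ _ fun w hw => invRate_pow_mul_le ?_ (hle w)
  have := hno w (mem_of_mem_erase hw) (ne_of_mem_erase hw)
  omega

/-- Here `e` is the number of neighbours of `y` other than the leaf. The worst case is e = 1, where
equality holds; the primed version excludes it and is smaller. -/
lemma single_leaf_bound_le (e : ℕ) :
    τ ^ (e + 2) + e * τ ^ (e + 3) ≤ τ ^ 3 + τ ^ 4 := by
  have h1 := invRate_sq_lt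
  have h2 := invRate_cube_gt
  have h3 := invRate_pow_four
  rcases e with _ | _ | e
  · norm_num; linarith
  · norm_num
  · have := natCast_mul_invRate_pow_le le_rfl (show 2 ≤ e + 2 by omega)
    have h4 := invRate_pow_le_pow (show 4 ≤ e + 2 + 2 by omega)
    have h5 : ((e + 2 : ℕ) : ℝ) * τ ^ (e + 2 + 3) ≤ 2 * τ ^ 5 := by
      calc ((e + 2 : ℕ) : ℝ) * τ ^ (e + 2 + 3)
          = τ ^ 2 * (((e + 2 : ℕ) : ℝ) * τ ^ (e + 2 + 1)) := by ring
        _ ≤ τ ^ 2 * ((2 : ℕ) * τ ^ (2 + 1)) := by gcongr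
        _ = 2 * τ ^ 5 := by push_cast; ring
    have := invRate_pow_five
    have := invRate_lt
    linarith

lemma single_leaf_bound_le' {e : ℕ} (he : 2 ≤ e) :
    τ ^ (e + 2) + e * τ ^ (e + 3) ≤ τ ^ 4 + 2 * τ ^ 5 := by
  have := natCast_mul_invRate_pow_le le_rfl he
  have h4 := invRate_pow_le_pow (show 4 ≤ e + 2 by omega)
  refine add_le_add h4 ?_
  calc (e : ℝ) * τ ^ (e + 3)
      = τ ^ 2 * (e * τ ^ (e + 1)) := by ring
    _ ≤ τ ^ 2 * ((2 : ℕ) * τ ^ (2 + 1)) := by gcongr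
    _ = 2 * τ ^ 5 := by push_cast; ring

lemma twins_bound_le {d : ℕ} (hd : 2 ≤ d) : τ ^ 3 + d * τ ^ (d + 1) ≤ 3 * τ ^ 3 := by
  have := natCast_mul_invRate_pow_le le_rfl hd
  push_cast at this
  linarith

lemma twins_bound_le' {d : ℕ} (hd : 3 ≤ d) : τ ^ 3 + d * τ ^ (d + 1) ≤ τ ^ 3 + 3 * τ ^ 4 := by
  have := natCast_mul_invRate_pow_le (by norm_num) hd
  push_cast at this
  linarith

/-- This dichotomy selects between the twin estimate and the single-leaf estimate. -/
lemma exists_twin_or (hy : y ∈ X) :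
    (∃ x' ∈ X, x' ≠ x ∧ G.nbr X x' = {y}) ∨ ∀ w ∈ G.nbr X y, w ≠ x → 2 ≤ #(G.nbr X w) := by
  by_contra! h
  obtain ⟨h1, w, hw, hwx, hlt⟩ := h
  exact h1 w (mem_nbr.1 hw).1 hwx (nbr_eq_singleton hy hw (by omega))

/-- The bound in the presence of a vertex of degree at most one. -/
lemma TriangleFree.dissocRatio_le_of_card_nbr_le_one (hG : G.TriangleFree)
    (hX : G.BoundBelow X) (hx : x ∈ X) (h : #(G.nbr X x) ≤ 1) :
    G.dissocRatio X ≤ τ ^ 2 + τ ^ 3 + τ ^ 4 := by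
  have t1 := invRate_lt
  have t2 := invRate_sq_gt
  have t3 := invRate_cube_gt
  have t4 := invRate_pow_four
  rcases Nat.le_one_iff_eq_zero_or_eq_one.1 h with h | h
  · have h1 := dissocRatio_le_of_nbr_eq_empty hx (card_eq_zero.1 h)
    have h2 := hX.ratio_le_one hx (mem_singleton_self x)
    have := mul_le_of_le_one_right invRate_pos.le h2
    linarith
  · obtain ⟨y, hxy⟩ := card_eq_one.1 h
    have hy : y ∈ X ∧ G.Adj x y := mem_nbr.1 (hxy ▸ mem_singleton_self y)
    rcases exists_twin_or (x := x) hy.1 with ⟨x', hx', hne, hx'y⟩ | hno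
    · obtain ⟨h2, hle⟩ := hG.dissocRatio_le_of_twins hX hx hx' hne.symm hxy hx'y
      have := twins_bound_le h2
      have := invRate_cube_lt
      linarith
    · obtain ⟨e, he⟩ := Nat.exists_eq_add_of_le'
        (one_le_card_nbr hx (hxy ▸ mem_singleton_self y : y ∈ G.nbr X x))
      have h1 := hG.dissocRatio_le_of_single_leaf hX hx hxy hno he
      have h2 := hX.ratio_le_one hx (mem_insert_self x {y})
      have := mul_le_of_le_one_right (pow_nonneg invRate_pos.le 2) h2
      have := single_leaf_bound_le e
      linarith

/-- The bound in the presence of a leaf whose neighbour has degree at least three. -/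
lemma TriangleFree.dissocRatio_le_of_leaf_of_three_le (hG : G.TriangleFree)
    (hX : G.BoundBelow X) (hx : x ∈ X) (hxy : G.nbr X x = {y}) (h3 : 3 ≤ #(G.nbr X y)) :
    G.dissocRatio X ≤ τ ^ 2 + τ ^ 4 + 2 * τ ^ 5 := by
  have t1 := invRate_gt
  have t2 := invRate_sq_gt
  have t3 := invRate_cube_lt
  have t4 := invRate_pow_four
  have t5 := invRate_pow_five
  have hy : y ∈ X ∧ G.Adj x y := mem_nbr.1 (hxy ▸ mem_singleton_self y)
  rcases exists_twin_or (x := x) hy.1 with ⟨x', hx', hne, hx'y⟩ | hno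
  · obtain ⟨h2, hle⟩ := hG.dissocRatio_le_of_twins hX hx hx' hne.symm hxy hx'y
    have := twins_bound_le' h3
    linarith
  · obtain ⟨e, he⟩ := Nat.exists_eq_add_of_le'
      (one_le_card_nbr hx (hxy ▸ mem_singleton_self y : y ∈ G.nbr X x))
    have h1 := hG.dissocRatio_le_of_single_leaf hX hx hxy hno he
    have h2 := hX.ratio_le_one hx (mem_insert_self x {y})
    have := mul_le_of_le_one_right (pow_nonneg invRate_pos.le 2) h2
    have := single_leaf_bound_le' (show 2 ≤ e by omega)
    linarith

/-- The bound in the presence of two nonadjacent leaves. -/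
lemma TriangleFree.dissocRatio_le_of_two_leaves (hG : G.TriangleFree)
    (hX : G.BoundBelow X) {x' y' : V} (hx : x ∈ X) (hx' : x' ∈ X) (hne : x ≠ x')
    (hxy : G.nbr X x = {y}) (hxy' : G.nbr X x' = {y'}) (hyx' : y ≠ x') :
    G.dissocRatio X ≤ 3 * τ ^ 3 ∧
      (3 ≤ #(G.nbr X y) → G.dissocRatio X ≤ τ ^ 3 + 3 * τ ^ 4) := by
  have t0 := invRate_pos
  have t1 := invRate_lt
  have t2 := invRate_sq_lt
  have t3 := invRate_cube_gt
  have t3' := invRate_cube_lt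
  have t4 := invRate_pow_four
  have t5 := invRate_pow_five
  have hy : y ∈ X ∧ G.Adj x y := mem_nbr.1 (hxy ▸ mem_singleton_self y)
  rcases exists_twin_or (x := x) hy.1 with ⟨x', hx', hne, hx'y⟩ | hno
  · obtain ⟨h2, hle⟩ := hG.dissocRatio_le_of_twins hX hx hx' hne.symm hxy hx'y
    exact ⟨hle.trans (twins_bound_le h2), fun h3 => hle.trans (twins_bound_le' h3)⟩
  · obtain ⟨e, he⟩ := Nat.exists_eq_add_of_le'
      (one_le_card_nbr hx (hxy ▸ mem_singleton_self y : y ∈ G.nbr X x))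
    have h1 := hG.dissocRatio_le_of_single_leaf hX hx hxy hno he
    -- The second leaf survives the deletion of `x` and `y` with degree at most one, so the
    -- low-degree bound applies once more.
    have h2 : G.dissocRatio (X \ {x, y}) ≤ τ ^ 2 + τ ^ 3 + τ ^ 4 := by
      refine hG.dissocRatio_le_of_card_nbr_le_one hX.sdiff (x := x') ?_ ?_
      · simp [hx', hne.symm, hyx'.symm]
      · rw [nbr_sdiff, hxy']
        exact (card_le_card sdiff_subset).trans (card_singleton _).le
    have h3 : τ ^ 2 * G.dissocRatio (X \ {x, y}) ≤ 0.40825 * (0.40825 + 0.26085 + 1 / 6) := by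
      have := G.dissocRatio_nonneg (X := X \ {x, y})
      gcongr
      linarith
    constructor
    · have := single_leaf_bound_le e
      norm_num at h3
      linarith
    · intro h
      have := single_leaf_bound_le' (show 2 ≤ e by omega)
      norm_num at h3
      linarith

/-! ### Minimum degree two: strict bounds away from four-cycles -/

/-- Only the ratio after deleting `v` alone is left unestimated: this branch has the largest weight,
and the new leaves there provide the savings. -/
lemma TriangleFree.dissocRatio_le_of_boundBelow (hG : G.TriangleFree) (hX : G.BoundBelow X)
    (hv : v ∈ X) :
    G.dissocRatio X ≤ τ * G.dissocRatio (X \ {v}) + τ ^ (#(G.nbr X v) + 1) +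
      ∑ u ∈ G.nbr X v, τ ^ (#(G.nbr X v) + #(G.nbr X u)) := by
  refine (hG.dissocRatio_le hv).trans (add_le_add (add_le_add le_rfl ?_) ?_)
  · exact invRate_pow_mul_le le_rfl (hX.ratio_le_one hv (mem_insert_self _ _))
  · refine sum_le_sum fun u hu => invRate_pow_mul_le le_rfl (hX.ratio_le_one hv ?_)
    exact mem_union_right _ (mem_nbr.2 ⟨hv, (mem_nbr.1 hu).2.symm⟩)

lemma sum_invRate_pow_le {A : Finset V} {k d : ℕ} (h : ∀ u ∈ A, k ≤ #(G.nbr X u)) :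
    ∑ u ∈ A, τ ^ (d + #(G.nbr X u)) ≤ #A * τ ^ (d + k) := by
  rw [← nsmul_eq_mul]
  exact sum_le_card_nsmul _ _ _ fun u hu => invRate_pow_le_pow (by have := h u hu; omega)

/-- The other neighbour of a vertex of degree two. -/
lemma exists_nbr_eq_pair (hu : u ∈ G.nbr X x) (h : #(G.nbr X x) = 2) :
    ∃ y, y ≠ u ∧ G.nbr X x = {u, y} := by
  obtain ⟨a, b, hab, he⟩ := card_eq_two.1 h
  rw [he, mem_insert, mem_singleton] at hu
  rcases hu with rfl | rfl
  · exact ⟨b, hab.symm, he⟩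
  · exact ⟨a, hab, by rw [he, pair_comm]⟩

/-- Deleting `v` turns a neighbour of degree two into a leaf. -/
lemma exists_nbr_sdiff_eq_singleton (hv : v ∈ X) (hx : x ∈ G.nbr X v) (h : #(G.nbr X x) = 2) :
    ∃ y, y ≠ v ∧ G.nbr X x = {v, y} ∧ G.nbr (X \ {v}) x = {y} := by
  obtain ⟨y, hy, he⟩ := exists_nbr_eq_pair (mem_nbr.2 ⟨hv, (mem_nbr.1 hx).2.symm⟩) h
  refine ⟨y, hy, he, ?_⟩
  rw [nbr_sdiff, he]
  ext a
  simp only [mem_sdiff, mem_insert, mem_singleton]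
  grind

lemma mem_sdiff_of_mem_nbr (hx : x ∈ G.nbr X v) : x ∈ X \ {v} := by
  simpa using ⟨(mem_nbr.1 hx).1, (mem_nbr.1 hx).2.ne'⟩

lemma nbr_sdiff_of_not_adj (h : ¬ G.Adj x v) : G.nbr (X \ {v}) x = G.nbr X x := by
  rw [nbr_sdiff, sdiff_singleton_eq_erase, erase_eq_of_notMem]
  exact fun hm => h (mem_nbr.1 hm).2

/-- A vertex of degree at least four. -/
lemma TriangleFree.dissocRatio_lt_one_of_four_le (hG : G.TriangleFree) (hX : G.BoundBelow X)
    (hmin : ∀ u ∈ X, 2 ≤ #(G.nbr X u)) (hv : v ∈ X) (h4 : 4 ≤ #(G.nbr X v)) :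
    G.dissocRatio X < 1 := by
  have t0 := invRate_pos
  have t1 := invRate_lt
  have t2 := invRate_sq_lt
  have t3 := invRate_cube_lt
  have t4 := invRate_pow_four
  have t5 := invRate_pow_five
  have t6 := invRate_pow_six
  have t7 := invRate_pow_seven
  have hle := hG.dissocRatio_le_of_boundBelow hX hv
  have h1 := hX.ratio_le_one hv (mem_singleton_self v)
  have h1' := mul_le_of_le_one_right invRate_pos.le h1
  have hmin' : ∀ u ∈ G.nbr X v, 2 ≤ #(G.nbr X u) := fun u hu => hmin u (mem_nbr.1 hu).1
  rcases h4.eq_or_lt with hv4 | h5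
  · rw [← hv4] at hle
    -- The crude bound τ + τ⁵ + 4τ⁶ is slightly above 1. Either a neighbour of degree two becomes a
    -- leaf and improves the first term, or the last term drops to 4τ⁷.
    by_cases hx : ∃ x ∈ G.nbr X v, #(G.nbr X x) = 2
    · obtain ⟨x, hx, hx2⟩ := hx
      obtain ⟨y, -, -, hy⟩ := exists_nbr_sdiff_eq_singleton hv hx hx2
      have h2 := hG.dissocRatio_le_of_card_nbr_le_one hX.sdiff (mem_sdiff_of_mem_nbr hx)
        (by rw [hy, card_singleton])
      have h3 := mul_le_mul_of_nonneg_left h2 t0.le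
      have h4 := sum_invRate_pow_le (d := 4) hmin'
      rw [← hv4] at h4
      norm_num at h4 hle
      linarith
    · have hmin3 : ∀ u ∈ G.nbr X v, 3 ≤ #(G.nbr X u) := fun u hu => by
        have := hmin' u hu
        have : #(G.nbr X u) ≠ 2 := fun h => hx ⟨u, hu, h⟩
        omega
      have h4 := sum_invRate_pow_le (d := 4) hmin3
      rw [← hv4] at h4
      norm_num at h4 hle
      linarith
  · have h3 := sum_invRate_pow_le (d := #(G.nbr X v)) hmin'
    have h6 := invRate_pow_le_pow (show 6 ≤ #(G.nbr X v) + 1 by omega)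
    have h7 := mul_le_mul_of_nonneg_left (natCast_mul_invRate_pow_le (by norm_num)
      (show 5 ≤ #(G.nbr X v) by omega)) t0.le
    have h8 : (#(G.nbr X v) : ℝ) * τ ^ (#(G.nbr X v) + 2) =
      τ * (#(G.nbr X v) * τ ^ (#(G.nbr X v) + 1)) := by ring
    have h9 : τ * ((5 : ℕ) * τ ^ (5 + 1)) = 5 * τ ^ 7 := by push_cast; ring
    linarith

/-- A vertex of degree three with a neighbour of degree two. -/
lemma TriangleFree.dissocRatio_le_of_three_two (hG : G.TriangleFree) (hX : G.BoundBelow X)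
    (hv : v ∈ X) (h3 : #(G.nbr X v) = 3) (hmin : ∀ u ∈ G.nbr X v, 2 ≤ #(G.nbr X u))
    (hx : x ∈ G.nbr X v) (hxy : G.nbr X x = {v, y}) (hyv : y ≠ v) :
    G.dissocRatio X < 1 ∧ (3 ≤ #(G.nbr X y) → G.dissocRatio X ≤ 0.98) := by
  have t0 := invRate_pos
  have t1 := invRate_lt
  have t2 := invRate_sq_lt
  have t3 := invRate_cube_lt
  have t4 := invRate_pow_four
  have t5 := invRate_pow_five
  have t6 := invRate_pow_six
  have hle := hG.dissocRatio_le_of_boundBelow hX hv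
  rw [h3] at hle
  norm_num at hle
  have hx2 : #(G.nbr X x) = 2 := by rw [hxy, card_pair hyv.symm]
  obtain ⟨y', hy'v, hxy', hx'⟩ := exists_nbr_sdiff_eq_singleton hv hx hx2
  obtain rfl : y' = y := by
    have : y' ∈ ({v, y} : Finset V) := by rw [← hxy, hxy']; simp
    simpa [hy'v] using this
  have hvx := (mem_nbr.1 hx).2
  have hadj : G.Adj x y' := (mem_nbr.1 (by rw [hxy]; simp : y' ∈ G.nbr X x)).2
  -- Hence deleting `v` leaves the degree of `y'` unchanged, as the sharper second bound requires.
  have hyv : ¬ G.Adj y' v := fun h => hG v x y' hvx hadj h.symm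
  have hnby : G.nbr (X \ {v}) y' = G.nbr X y' := nbr_sdiff_of_not_adj hyv
  have hxX := mem_sdiff_of_mem_nbr hx
  by_cases hz : ∃ z ∈ G.nbr X v, z ≠ x ∧ #(G.nbr X z) = 2
  · obtain ⟨z, hz, hzx, hz2⟩ := hz
    obtain ⟨y₂, -, -, hz'⟩ := exists_nbr_sdiff_eq_singleton hv hz hz2
    have hy'z : y' ≠ z := by
      rintro rfl
      exact hyv (mem_nbr.1 hz).2.symm
    obtain ⟨ha, hb⟩ := hG.dissocRatio_le_of_two_leaves hX.sdiff hxX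
      (mem_sdiff_of_mem_nbr hz) hzx.symm hx' hz' hy'z
    have hsum := sum_invRate_pow_le (d := 3) hmin
    rw [h3] at hsum
    norm_num at hsum
    constructor
    · have := mul_le_mul_of_nonneg_left ha t0.le
      have : τ * (3 * τ ^ 3) = 3 * τ ^ 4 := by ring
      linarith
    · intro hy3
      have := mul_le_mul_of_nonneg_left (hb (hnby ▸ hy3)) t0.le
      have : τ * (τ ^ 3 + 3 * τ ^ 4) = τ ^ 4 + 3 * τ ^ 5 := by ring
      norm_num
      linarith
  · have hsum : ∑ u ∈ G.nbr X v, τ ^ (3 + #(G.nbr X u)) ≤ τ ^ 5 + 2 * τ ^ 6 := by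
      rw [← add_sum_erase _ _ hx]
      refine add_le_add (invRate_pow_le_pow (by omega)) ?_
      have := sum_invRate_pow_le (G := G) (X := X) (A := (G.nbr X v).erase x) (k := 3) (d := 3)
        fun u hu => by
          have := hmin u (mem_of_mem_erase hu)
          have : #(G.nbr X u) ≠ 2 := fun h =>
            hz ⟨u, mem_of_mem_erase hu, ne_of_mem_erase hu, h⟩
          omega
      rw [card_erase_of_mem hx, h3] at this
      norm_num at this
      exact this
    constructor
    · have := mul_le_mul_of_nonneg_left (hG.dissocRatio_le_of_card_nbr_le_one hX.sdiff hxX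
        (by rw [hx', card_singleton])) t0.le
      have : τ * (τ ^ 2 + τ ^ 3 + τ ^ 4) = τ ^ 3 + τ ^ 4 + τ ^ 5 := by ring
      linarith
    · intro hy3
      have := mul_le_mul_of_nonneg_left (hG.dissocRatio_le_of_leaf_of_three_le hX.sdiff hxX
        hx' (hnby ▸ hy3)) t0.le
      have : τ * (τ ^ 2 + τ ^ 4 + 2 * τ ^ 5) = τ ^ 3 + τ ^ 5 + 2 * τ ^ 6 := by ring
      norm_num
      linarith

/-- A vertex of degree three, when all vertices in its component have degree three. -/
lemma TriangleFree.dissocRatio_lt_one_of_cubic (hG : G.TriangleFree) (hX : G.BoundBelow X)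
    (hv : v ∈ X) (h3 : #(G.nbr X v) = 3)
    (hreg : ∀ a ∈ X, #(G.nbr X a) = 3 → ∀ b ∈ G.nbr X a, #(G.nbr X b) = 3) :
    G.dissocRatio X < 1 := by
  have t0 := invRate_pos
  have t1 := invRate_lt
  have t2 := invRate_sq_lt
  have t4 := invRate_pow_four
  have t6 := invRate_pow_six
  obtain ⟨u, hu⟩ : (G.nbr X v).Nonempty := card_pos.1 (by omega)
  have hvu : v ∈ G.nbr X u := mem_nbr.2 ⟨hv, (mem_nbr.1 hu).2.symm⟩
  have hu3 := hreg v hv h3 u hu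
  have hu' : G.nbr (X \ {v}) u = (G.nbr X u).erase v := by rw [nbr_sdiff, sdiff_singleton_eq_erase]
  have hu2 : #(G.nbr (X \ {v}) u) = 2 := by rw [hu', card_erase_of_mem hvu, hu3]
  obtain ⟨w, hw⟩ : (G.nbr (X \ {v}) u).Nonempty := card_pos.1 (by omega)
  have key : ∀ a ∈ G.nbr (X \ {v}) u, a ∈ X ∧ #(G.nbr X a) = 3 ∧
      G.nbr (X \ {v}) a = G.nbr X a := by
    intro a ha
    have ha' : a ∈ G.nbr X u := by rw [hu'] at ha; exact mem_of_mem_erase ha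
    refine ⟨(mem_nbr.1 ha').1, hreg u (mem_nbr.1 hu).1 hu3 a ha', nbr_sdiff_of_not_adj fun h => ?_⟩
    exact hG v u a (mem_nbr.1 hu).2 (mem_nbr.1 ha').2 h.symm
  obtain ⟨y, hyw, hwy⟩ := exists_nbr_eq_pair hw hu2
  obtain ⟨hwX, hw3, hw'⟩ := key w hw
  have hy : y ∈ G.nbr (X \ {v}) u := by rw [hwy]; simp
  obtain ⟨-, hy3, hy'⟩ := key y hy
  have huw : u ∈ G.nbr (X \ {v}) w :=
    mem_nbr.2 ⟨mem_sdiff_of_mem_nbr hu, (mem_nbr.1 hw).2.symm⟩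
  -- Without `v`, the vertex `u` has degree two between `w` and `y`, both still of degree three. The
  -- resulting 0.98 is needed: τ + τ⁴ + 3τ⁶ exceeds 1, while 0.98τ + τ⁴ + 3τ⁶ does not.
  have h1 := (hG.dissocRatio_le_of_three_two hX.sdiff (mem_nbr.1 hw).1 (hw'.symm ▸ hw3)
    (fun z hz => ?_) huw hwy hyw).2 (by rw [hy', hy3])
  · have hle := hG.dissocRatio_le_of_boundBelow hX hv
    have hsum := sum_invRate_pow_le (d := 3) fun a ha => (hreg v hv h3 a ha).ge
    rw [h3] at hsum hle
    norm_num at hsum hle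
    have := mul_le_mul_of_nonneg_left h1 t0.le
    linarith
  · rw [hw'] at hz
    have hz3 := hreg w hwX hw3 z hz
    have := le_card_sdiff {v} (G.nbr X z)
    rw [hz3, card_singleton] at this
    rwa [nbr_sdiff]

/-- Two adjacent vertices of degree two whose outer neighbours differ, in a 2-regular graph. -/
lemma TriangleFree.dissocRatio_lt_one_of_two_regular (hG : G.TriangleFree) (hX : G.BoundBelow X)
    {u₁ u₂ w₁ w₂ : V} (hv : v ∈ X) (h2 : ∀ a ∈ X, #(G.nbr X a) = 2) (hu : u₁ ≠ u₂)
    (hnv : G.nbr X v = {u₁, u₂}) (hw₁ : w₁ ≠ v) (hw₂ : w₂ ≠ v) (hn₁ : G.nbr X u₁ = {v, w₁})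
    (hn₂ : G.nbr X u₂ = {v, w₂}) (hw : w₁ ≠ w₂) : G.dissocRatio X < 1 := by
  have t0 := invRate_pos
  have t1 := invRate_lt
  have t2 := invRate_sq_lt
  have t3 := invRate_cube_lt
  have t4 := invRate_pow_four
  have t5 := invRate_pow_five
  have t6 := invRate_pow_six
  have t7 := invRate_pow_seven
  have m₁ : u₁ ∈ G.nbr X v := by rw [hnv]; simp
  have m₂ : u₂ ∈ G.nbr X v := by rw [hnv]; simp
  have k₁ : w₁ ∈ G.nbr X u₁ := by rw [hn₁]; simp
  have k₂ : w₂ ∈ G.nbr X u₂ := by rw [hn₂]; simp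
  have a₁ := (mem_nbr.1 m₁).2
  have a₂ := (mem_nbr.1 m₂).2
  have b₁ := (mem_nbr.1 k₁).2
  have b₂ := (mem_nbr.1 k₂).2
  have hnu : ¬ G.Adj u₁ u₂ := fun h => hG v u₁ u₂ a₁ h a₂
  have hw₁u : w₁ ≠ u₂ := by rintro rfl; exact hnu b₁
  have hw₂u : w₂ ≠ u₁ := by rintro rfl; exact hnu b₂.symm
  have deg : ∀ {w u : V} {D : Finset V}, w ∈ X → u ∈ X → G.Adj u w → u ∈ D →
      #(G.nbr (X \ D) w) ≤ 1 := by
    intro w u D hwX huX huw huD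
    have hm : u ∈ G.nbr X w := mem_nbr.2 ⟨huX, huw.symm⟩
    have : G.nbr (X \ D) w ⊆ (G.nbr X w).erase u := by
      rw [nbr_sdiff]
      intro a ha
      rw [mem_sdiff] at ha
      exact mem_erase.2 ⟨by rintro rfl; exact ha.2 huD, ha.1⟩
    have := card_le_card this
    rwa [card_erase_of_mem hm, h2 w hwX] at this
  have s₁ : G.nbr (X \ {v}) u₁ = {w₁} := by
    rw [nbr_sdiff, hn₁]; ext; simp only [mem_sdiff, mem_insert, mem_singleton]; grind
  have s₂ : G.nbr (X \ {v}) u₂ = {w₂} := by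
    rw [nbr_sdiff, hn₂]; ext; simp only [mem_sdiff, mem_insert, mem_singleton]; grind
  -- All four branches at `v` need a saving, as the total is about 0.997. Deleting `v` leaves two
  -- leaves; in the others some `w₁` or `w₂` survives with degree at most one, which for the last
  -- two uses `w₁ ≠ w₂`.
  have r₀ := (hG.dissocRatio_le_of_two_leaves hX.sdiff (mem_sdiff_of_mem_nbr m₁)
    (mem_sdiff_of_mem_nbr m₂) hu s₁ s₂ hw₁u).1
  have r₁ : G.dissocRatio (X \ insert v (G.nbr X v)) ≤ τ ^ 2 + τ ^ 3 + τ ^ 4 := by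
    refine hG.dissocRatio_le_of_card_nbr_le_one hX.sdiff (x := w₁) ?_
      (deg (mem_nbr.1 k₁).1 (mem_nbr.1 m₁).1 b₁ (mem_insert_of_mem m₁))
    simp [(mem_nbr.1 k₁).1, hnv, hw₁, b₁.ne', hw₁u]
  have r₂ : G.dissocRatio (X \ (G.nbr X v ∪ G.nbr X u₁)) ≤ τ ^ 2 + τ ^ 3 + τ ^ 4 := by
    refine hG.dissocRatio_le_of_card_nbr_le_one hX.sdiff (x := w₂) ?_
      (deg (mem_nbr.1 k₂).1 (mem_nbr.1 m₂).1 b₂ (mem_union_left _ m₂))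
    simp [(mem_nbr.1 k₂).1, hnv, hn₁, hw₂, b₂.ne', hw₂u, hw.symm]
  have r₃ : G.dissocRatio (X \ (G.nbr X v ∪ G.nbr X u₂)) ≤ τ ^ 2 + τ ^ 3 + τ ^ 4 := by
    refine hG.dissocRatio_le_of_card_nbr_le_one hX.sdiff (x := w₁) ?_
      (deg (mem_nbr.1 k₁).1 (mem_nbr.1 m₁).1 b₁ (mem_union_left _ m₁))
    simp [(mem_nbr.1 k₁).1, hnv, hn₂, hw₁, b₁.ne', hw₁u, hw]
  have hle := hG.dissocRatio_le hv
  have hs : ∑ u ∈ G.nbr X v, τ ^ (#(G.nbr X v) + #(G.nbr X u)) *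
      G.dissocRatio (X \ (G.nbr X v ∪ G.nbr X u)) =
      τ ^ 4 * G.dissocRatio (X \ (G.nbr X v ∪ G.nbr X u₁)) +
      τ ^ 4 * G.dissocRatio (X \ (G.nbr X v ∪ G.nbr X u₂)) := by
    have e₁ := h2 _ (mem_nbr.1 m₁).1
    have e₂ := h2 _ (mem_nbr.1 m₂).1
    have : ∀ f : V → ℝ, ∑ u ∈ G.nbr X v, f u = f u₁ + f u₂ := fun f => by
      rw [hnv, sum_pair hu]
    rw [this, e₁, e₂, h2 v hv]
  rw [hs, h2 v hv] at hle
  have q₀ := mul_le_mul_of_nonneg_left r₀ t0.le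
  have q₁ := mul_le_mul_of_nonneg_left r₁ (pow_nonneg t0.le (2 + 1))
  have q₂ := mul_le_mul_of_nonneg_left r₂ (pow_nonneg t0.le 4)
  have q₃ := mul_le_mul_of_nonneg_left r₃ (pow_nonneg t0.le 4)
  have : τ * (3 * τ ^ 3) = 3 * τ ^ 4 := by ring
  have : τ ^ (2 + 1) * (τ ^ 2 + τ ^ 3 + τ ^ 4) = τ ^ 5 + τ ^ 6 + τ ^ 7 := by ring
  norm_num only at hle q₁ this
  rw [this, t5, t6, t7] at q₁
  rw [t4] at q₂ q₃ hle
  rw [‹τ * (3 * τ ^ 3) = _›, t4] at q₀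
  linarith only [hle, q₀, q₁, q₂, q₃, t1, t2, t3]

/-! ### Four-cycle components -/

/-- A maximal dissociation set meets every union of components in at least two vertices, if that
union has at least two vertices. -/
lemma IsMaxDissocIn.two_le_card_inter (hF : G.IsMaxDissocIn X F) {K : Finset V} (hK : K ⊆ X)
    (hK2 : 2 ≤ #K) (hN : ∀ a ∈ K, G.nbr X a ⊆ K) : 2 ≤ #(F ∩ K) := by
  by_contra! hlt
  obtain ⟨x, hxK, hxF⟩ : ∃ x ∈ K, x ∉ F := by
    by_contra! h
    rw [inter_eq_right.2 h] at hlt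
    omega
  refine hF.2.2 x (hK hxK) hxF ?_
  have hcard : #(insert x F ∩ K) ≤ 2 := by
    rw [insert_inter_of_mem hxK]
    exact (card_insert_le _ _).trans (by omega)
  have hsub : insert x F ⊆ X := insert_subset (hK hxK) hF.1
  intro a ha b hb c hc hab hac
  by_cases haK : a ∈ K
  · have hbK := hN a haK (mem_nbr.2 ⟨hsub hb, hab⟩)
    have hcK := hN a haK (mem_nbr.2 ⟨hsub hc, hac⟩)
    by_contra hbc
    have : #({a, b, c} : Finset V) = 3 := card_eq_three.2 ⟨a, b, c, hab.ne, hac.ne, hbc, rfl⟩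
    have h3 : ({a, b, c} : Finset V) ⊆ insert x F ∩ K := by
      simp only [insert_subset_iff, singleton_subset_iff, mem_inter]
      exact ⟨⟨ha, haK⟩, ⟨hb, hbK⟩, hc, hcK⟩
    have := card_le_card h3
    omega
  · have key : ∀ b ∈ insert x F, G.Adj a b → b ∈ F := by
      intro b hb hab
      rcases mem_insert.1 hb with rfl | h
      · exact absurd (hN b hxK (mem_nbr.2 ⟨hsub ha, hab.symm⟩)) haK
      · exact h
    have haF : a ∈ F := (mem_insert.1 ha).resolve_left (by rintro rfl; exact haK hxK)
    exact hF.2.1 a haF b (key b hb hab) c (key c hc hac) hab hac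

/-- Removing a component that is a four-cycle does not decrease the ratio. -/
lemma dissocRatio_le_sdiff_four_cycle {u₁ u₂ : V} (hvw : v ≠ w) (hu : u₁ ≠ u₂) (hv : v ∈ X)
    (hw : w ∈ X) (hnv : G.nbr X v = {u₁, u₂}) (hnw : G.nbr X w = {u₁, u₂})
    (hn₁ : G.nbr X u₁ = {v, w}) (hn₂ : G.nbr X u₂ = {v, w}) :
    G.dissocRatio X ≤ G.dissocRatio (X \ {v, u₁, w, u₂}) := by
  have v₁ : u₁ ∈ X ∧ G.Adj v u₁ := mem_nbr.1 (by rw [hnv]; simp)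
  have v₂ : u₂ ∈ X ∧ G.Adj v u₂ := mem_nbr.1 (by rw [hnv]; simp)
  have w₁ : u₁ ∈ X ∧ G.Adj w u₁ := mem_nbr.1 (by rw [hnw]; simp)
  have w₂ : u₂ ∈ X ∧ G.Adj w u₂ := mem_nbr.1 (by rw [hnw]; simp)
  set K : Finset V := {v, u₁, w, u₂} with hKdef
  have hK : K ⊆ X := by simp [hKdef, insert_subset_iff, hv, hw, v₁.1, v₂.1]
  have hK4 : #K = 4 := by
    have := v₁.2.ne
    have := v₂.2.ne
    have := w₁.2.ne'
    have := w₂.2.ne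
    rw [hKdef, card_insert_of_notMem, card_insert_of_notMem, card_pair] <;> simp_all
  have hN : ∀ a ∈ K, G.nbr X a ⊆ K := by
    intro a ha
    simp only [hKdef, mem_insert, mem_singleton] at ha
    rcases ha with rfl | rfl | rfl | rfl
    · rw [hnv]; simp [hKdef, insert_subset_iff]
    · rw [hn₁]; simp [hKdef, insert_subset_iff]
    · rw [hnw]; simp [hKdef, insert_subset_iff]
    · rw [hn₂]; simp [hKdef, insert_subset_iff]
  have h := dissocRatio_le_sum (G := G) (X := X) (powersetCard 2 K) (fun _ => K) id
    (fun _ _ => hK) (fun S hS s hs => hN s ((mem_powersetCard.1 hS).1 hs)) ?_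
  · refine h.trans (le_of_eq ?_)
    rw [sum_const, card_powersetCard, hK4, invRate_pow_four, nsmul_eq_mul]
    norm_num [Nat.choose]
    ring
  · intro F hF
    refine ⟨F ∩ K, mem_powersetCard.2 ⟨inter_subset_right, ?_⟩, rfl⟩
    refine le_antisymm ?_ (hF.two_le_card_inter hK (by omega) hN)
    have hd := hF.2.1
    -- Any three vertices of a four-cycle induce a path, whose middle vertex has degree two.
    obtain ⟨p, q, hpq⟩ : ∃ p q, F ∩ K ⊆ {p, q} := by
      have c₁ : u₁ ∈ F → v ∈ F → w ∉ F := fun h hv hw =>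
        hvw (hd u₁ h v hv w hw v₁.2.symm w₁.2.symm)
      have c₂ : u₂ ∈ F → v ∈ F → w ∉ F := fun h hv hw =>
        hvw (hd u₂ h v hv w hw v₂.2.symm w₂.2.symm)
      have c₃ : v ∈ F → u₁ ∈ F → u₂ ∉ F := fun h h₁ h₂ => hu (hd v h u₁ h₁ u₂ h₂ v₁.2 v₂.2)
      have c₄ : w ∈ F → u₁ ∈ F → u₂ ∉ F := fun h h₁ h₂ => hu (hd w h u₁ h₁ u₂ h₂ w₁.2 w₂.2)
      have hsub : ∀ p q, (∀ a ∈ F, a = v ∨ a = u₁ ∨ a = w ∨ a = u₂ → a = p ∨ a = q) →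
          F ∩ K ⊆ {p, q} := fun p q h a ha => by
        rw [mem_inter, hKdef] at ha
        simp only [mem_insert, mem_singleton] at ha ⊢
        exact h a ha.1 ha.2
      by_cases hv' : v ∈ F <;> by_cases h₁ : u₁ ∈ F
      · exact ⟨v, u₁, hsub _ _ (by grind)⟩
      · by_cases h₂ : u₂ ∈ F
        · exact ⟨v, u₂, hsub _ _ (by grind)⟩
        · exact ⟨v, w, hsub _ _ (by grind)⟩
      · by_cases h₂ : u₂ ∈ F
        · exact ⟨u₁, u₂, hsub _ _ (by grind)⟩
        · exact ⟨u₁, w, hsub _ _ (by grind)⟩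
      · exact ⟨w, u₂, hsub _ _ (by grind)⟩
    exact (card_le_card hpq).trans card_le_two

/-- The map `f` identifies the four-cycle with a component of `G[X]`. -/
structure IsFourCycleComponent (G : SimpleGraph V) (X : Finset V) (f : Fin 4 → V) : Prop where
  injective : Function.Injective f
  mem : ∀ i, f i ∈ X
  adj_iff : ∀ i j, G.Adj (f i) (f j) ↔ (cycleGraph 4).Adj i j
  closed : ∀ i, ∀ a ∈ X, G.Adj (f i) a → a ∈ univ.image f

lemma TriangleFree.isFourCycleComponent (hG : G.TriangleFree) {u₁ u₂ : V} (hvw : v ≠ w)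
    (hu : u₁ ≠ u₂) (hv : v ∈ X) (hw : w ∈ X) (hnv : G.nbr X v = {u₁, u₂})
    (hnw : G.nbr X w = {u₁, u₂}) (hn₁ : G.nbr X u₁ = {v, w}) (hn₂ : G.nbr X u₂ = {v, w}) :
    G.IsFourCycleComponent X ![v, u₁, w, u₂] := by
  have v₁ : u₁ ∈ X ∧ G.Adj v u₁ := mem_nbr.1 (by rw [hnv]; simp)
  have v₂ : u₂ ∈ X ∧ G.Adj v u₂ := mem_nbr.1 (by rw [hnv]; simp)
  have w₁ : u₁ ∈ X ∧ G.Adj w u₁ := mem_nbr.1 (by rw [hnw]; simp)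
  have w₂ : u₂ ∈ X ∧ G.Adj w u₂ := mem_nbr.1 (by rw [hnw]; simp)
  have n₁ : ¬ G.Adj v w := fun h => hG v u₁ w v₁.2 w₁.2.symm h
  have n₂ : ¬ G.Adj u₁ u₂ := fun h => hG u₁ v u₂ v₁.2.symm v₂.2 h
  have himg : univ.image ![v, u₁, w, u₂] = {v, u₁, w, u₂} := by
    ext a; simp [Fin.exists_fin_succ, eq_comm]
  refine ⟨?_, ?_, ?_, ?_⟩
  · have := v₁.2.ne
    have := v₂.2.ne
    have := w₁.2.ne
    have := w₂.2.ne
    intro i j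
    fin_cases i <;> fin_cases j <;> simp <;> grind
  · intro i
    fin_cases i <;> simp [hv, hw, v₁.1, v₂.1]
  · intro i j
    have l := G.loopless.irrefl
    have v₁' := v₁.2
    have v₂' := v₂.2
    have w₁' := w₁.2
    have w₂' := w₂.2
    fin_cases i <;> fin_cases j <;>
      simp [v₁', v₂', w₁', w₂', v₁'.symm, v₂'.symm, w₁'.symm, w₂'.symm, n₁, n₂,
        mt G.adj_symm n₁, mt G.adj_symm n₂, cycleGraph_adj] <;> decide
  · intro i a ha hia
    have : a ∈ G.nbr X (![v, u₁, w, u₂] i) := mem_nbr.2 ⟨ha, hia⟩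
    rw [himg]
    fin_cases i <;> simp_all <;> grind

/-! ### The inductive dichotomy, the bound and the equality case -/

/-- A nonempty graph satisfies the bound strictly or has a four-cycle as a component. -/
lemma TriangleFree.dissocRatio_lt_one_or (hG : G.TriangleFree) (hX : G.BoundBelow X)
    (hne : X.Nonempty) : G.dissocRatio X < 1 ∨
      ∃ f, G.IsFourCycleComponent X f ∧ G.dissocRatio X ≤ G.dissocRatio (X \ univ.image f) := by
  by_cases h1 : ∃ x ∈ X, #(G.nbr X x) ≤ 1
  · obtain ⟨x, hx, h⟩ := h1
    have := hG.dissocRatio_le_of_card_nbr_le_one hX hx h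
    left
    linarith [invRate_sq_lt, invRate_cube_lt, invRate_pow_four]
  have hmin : ∀ x ∈ X, 2 ≤ #(G.nbr X x) := fun x hx => by
    by_contra! h
    exact h1 ⟨x, hx, by omega⟩
  by_cases h4 : ∃ x ∈ X, 4 ≤ #(G.nbr X x)
  · obtain ⟨x, hx, h⟩ := h4
    exact Or.inl (hG.dissocRatio_lt_one_of_four_le hX hmin hx h)
  have hmax : ∀ x ∈ X, #(G.nbr X x) ≤ 3 := fun x hx => by
    by_contra! h
    exact h4 ⟨x, hx, by omega⟩
  by_cases h3 : ∃ x ∈ X, #(G.nbr X x) = 3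
  · left
    obtain ⟨v, hv, hv3⟩ := h3
    by_cases hreg : ∀ a ∈ X, #(G.nbr X a) = 3 → ∀ b ∈ G.nbr X a, #(G.nbr X b) = 3
    · exact hG.dissocRatio_lt_one_of_cubic hX hv hv3 hreg
    · push Not at hreg
      obtain ⟨a, ha, ha3, b, hb, hb3⟩ := hreg
      have h2 := hmin b (mem_nbr.1 hb).1
      have h3 := hmax b (mem_nbr.1 hb).1
      obtain ⟨y, hya, hy⟩ := exists_nbr_eq_pair (mem_nbr.2 ⟨ha, (mem_nbr.1 hb).2.symm⟩)
        (show #(G.nbr X b) = 2 by omega)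
      exact (hG.dissocRatio_le_of_three_two hX ha ha3
        (fun u hu => hmin u (mem_nbr.1 hu).1) hb hy hya).1
  have h2 : ∀ x ∈ X, #(G.nbr X x) = 2 := fun x hx => by
    have := hmin x hx
    have := hmax x hx
    have : #(G.nbr X x) ≠ 3 := fun h => h3 ⟨x, hx, h⟩
    omega
  obtain ⟨v, hv⟩ := hne
  obtain ⟨u₁, u₂, hu, hnv⟩ := card_eq_two.1 (h2 v hv)
  have m₁ : u₁ ∈ X ∧ G.Adj v u₁ := mem_nbr.1 (by rw [hnv]; simp)
  have m₂ : u₂ ∈ X ∧ G.Adj v u₂ := mem_nbr.1 (by rw [hnv]; simp)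
  obtain ⟨w₁, hw₁, hn₁⟩ := exists_nbr_eq_pair (mem_nbr.2 ⟨hv, m₁.2.symm⟩) (h2 u₁ m₁.1)
  obtain ⟨w₂, hw₂, hn₂⟩ := exists_nbr_eq_pair (mem_nbr.2 ⟨hv, m₂.2.symm⟩) (h2 u₂ m₂.1)
  -- In a 2-regular graph, the outer neighbours of `u₁` and `u₂` coincide exactly when the cycle
  -- through `v` has length four.
  by_cases hw : w₁ = w₂
  · subst hw
    right
    have k₁ : w₁ ∈ X ∧ G.Adj u₁ w₁ := mem_nbr.1 (by rw [hn₁]; simp)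
    have k₂ : w₁ ∈ X ∧ G.Adj u₂ w₁ := mem_nbr.1 (by rw [hn₂]; simp)
    have hnw : G.nbr X w₁ = {u₁, u₂} := by
      refine (eq_of_subset_of_card_le ?_ (by rw [h2 _ k₁.1, card_pair hu])).symm
      simp [insert_subset_iff, mem_nbr, m₁.1, m₂.1, k₁.2.symm, k₂.2.symm]
    refine ⟨_, hG.isFourCycleComponent hw₁.symm hu hv k₁.1 hnv hnw hn₁ hn₂, ?_⟩
    have himg : univ.image ![v, u₁, w₁, u₂] = {v, u₁, w₁, u₂} := by
      ext a; simp [Fin.exists_fin_succ, eq_comm]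
    rw [himg]
    exact dissocRatio_le_sdiff_four_cycle hw₁.symm hu hv k₁.1 hnv hnw hn₁ hn₂
  · exact Or.inl (hG.dissocRatio_lt_one_of_two_regular hX hv h2 hu hnv hw₁ hw₂ hn₁ hn₂ hw)

lemma TriangleFree.dissocRatio_le_one (hG : G.TriangleFree) (X : Finset V) :
    G.dissocRatio X ≤ 1 := by
  induction X using Finset.strongInduction with
  | H X ih =>
    rcases X.eq_empty_or_nonempty with rfl | hne
    · have h : #(G.maxDissocIn ∅) ≤ 1 :=
        (card_le_card fun F hF => mem_powerset.2 (mem_maxDissocIn.1 hF).1).trans (by simp)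
      simpa [dissocRatio] using h
    · rcases hG.dissocRatio_lt_one_or ih hne with h | ⟨f, hf, h⟩
      · exact h.le
      · refine h.trans (BoundBelow.ratio_le_one ih (hf.mem 0) (mem_image_of_mem f (mem_univ 0)))

/-- `G[X]` is isomorphic to a disjoint union of four-cycles. -/
def IsFourCycleUnion (G : SimpleGraph V) (X : Finset V) : Prop :=
  ∃ (k : ℕ) (e : Fin k × Fin 4 → V), Function.Injective e ∧ univ.image e = X ∧
    ∀ p q, G.Adj (e p) (e q) ↔ (copies k (cycleGraph 4)).Adj p q

lemma IsFourCycleComponent.isFourCycleUnion {f : Fin 4 → V} (hf : G.IsFourCycleComponent X f)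
    (h : G.IsFourCycleUnion (X \ univ.image f)) : G.IsFourCycleUnion X := by
  obtain ⟨k, e, he, himg, hadj⟩ := h
  have hmem : ∀ p, e p ∈ X ∧ ∀ i, f i ≠ e p := fun p => by
    have : e p ∈ X \ univ.image f := himg ▸ mem_image_of_mem e (mem_univ p)
    simpa using this
  have hno : ∀ p i, ¬ G.Adj (f i) (e p) := fun p i hp => by
    have := hf.closed i _ (hmem p).1 hp
    simp only [mem_image, mem_univ, true_and] at this
    obtain ⟨j, hj⟩ := this
    exact (hmem p).2 j hj
  -- The new component becomes copy 0 and the old copies are shifted by one.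
  refine ⟨k + 1, fun p => Fin.cases (f p.2) (fun i => e (i, p.2)) p.1, ?_, ?_, ?_⟩
  · rintro ⟨i, a⟩ ⟨j, b⟩ hij
    refine Fin.cases ?_ (fun i => ?_) i hij <;> refine Fin.cases ?_ (fun j => ?_) j <;> intro h
    · simpa using hf.injective h
    · exact absurd h ((hmem _).2 _)
    · exact absurd h.symm ((hmem _).2 _)
    · have := he h
      simp_all
  · ext a
    have h1 : a ∈ univ.image e ↔ a ∈ X \ univ.image f := by rw [himg]
    have h2 : ∀ i, f i = a → a ∈ X := fun i h => h ▸ hf.mem i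
    simp only [mem_image, mem_univ, true_and, Prod.exists, Fin.exists_fin_succ, Fin.cases_zero,
      Fin.cases_succ, mem_sdiff] at h1 ⊢
    grind
  · rintro ⟨i, a⟩ ⟨j, b⟩
    refine Fin.cases ?_ (fun i => ?_) i <;> refine Fin.cases ?_ (fun j => ?_) j
    · simp [copies, hf.adj_iff]
    · simpa [copies, (Fin.succ_ne_zero _).symm] using hno _ _
    · simpa [copies] using fun h => hno _ _ (G.adj_symm h)
    · simp [copies, hadj]

/-- A ratio of at least 1 rules out the strict alternative, and the hypothesis passes to what
remains after removing a four-cycle. -/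
lemma TriangleFree.isFourCycleUnion_of_one_le (hG : G.TriangleFree) (X : Finset V)
    (h1 : 1 ≤ G.dissocRatio X) : G.IsFourCycleUnion X := by
  induction X using Finset.strongInduction with
  | H X ih =>
    rcases X.eq_empty_or_nonempty with rfl | hne
    · exact ⟨0, fun p => p.1.elim0, fun p => p.1.elim0, by ext; simp, fun p => p.1.elim0⟩
    · rcases hG.dissocRatio_lt_one_or (fun Y _ => hG.dissocRatio_le_one Y) hne with h | ⟨f, hf, h⟩
      · linarith
      · refine hf.isFourCycleUnion (ih _ ?_ (h1.trans h))
        exact ⟨sdiff_subset, fun hs =>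
          (mem_sdiff.1 (hs (hf.mem 0))).2 (mem_image_of_mem f (mem_univ 0))⟩

/-! ### Transfer to the original definitions -/

lemma isDissociationSet_coe_iff : G.IsDissociationSet (F : Set V) ↔ G.IsDissoc F := by
  unfold IsDissociationSet IsDissoc
  simp only [Set.encard_le_one_iff, Subtype.forall, mem_neighborSet, comap_adj,
    Function.Embedding.subtype_apply, Subtype.mk.injEq, mem_coe]

variable [Fintype V]

lemma isMaximalDissociationSet_coe_iff :
    G.IsMaximalDissociationSet (F : Set V) ↔ G.IsMaxDissocIn univ F := by
  unfold IsMaximalDissociationSet IsMaxDissocIn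
  rw [isDissociationSet_coe_iff]
  simp only [subset_univ, true_and, mem_univ, forall_true_left]
  refine and_congr_right fun _ => ⟨fun h x hx hd => ?_, fun h F' hF' hlt => ?_⟩
  · exact h _ (isDissociationSet_coe_iff.2 hd) (by exact_mod_cast ssubset_insert hx)
  · obtain ⟨F', rfl⟩ := F'.toFinite.exists_finset_coe
    obtain ⟨x, hx, hsub⟩ := (ssubset_iff).1 (show F ⊂ F' by exact_mod_cast hlt)
    exact h x hx ((isDissociationSet_coe_iff.1 hF').mono hsub)

lemma numMaximalDissociationSets_eq_card :
    G.numMaximalDissociationSets = #(G.maxDissocIn univ) := by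
  rw [← Set.ncard_coe_finset, ← Set.ncard_image_of_injective _ (coe_injective (α := V))]
  unfold numMaximalDissociationSets
  congr 1
  ext F
  obtain ⟨F, rfl⟩ := F.toFinite.exists_finset_coe
  simp [isMaximalDissociationSet_coe_iff, mem_maxDissocIn]

lemma numMaximalDissociationSets_eq_dissocRatio_mul :
    (G.numMaximalDissociationSets : ℝ) =
      G.dissocRatio univ * (6 : ℝ) ^ ((Fintype.card V : ℝ) / 4) := by
  have : τ ^ Fintype.card V * (6 : ℝ) ^ ((Fintype.card V : ℝ) / 4) = 1 := by
    rw [invRate, ← Real.rpow_natCast, ← Real.rpow_mul (by norm_num),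
      ← Real.rpow_add (by norm_num)]
    ring_nf
    simp
  rw [numMaximalDissociationSets_eq_card, dissocRatio, card_univ, mul_assoc, this, mul_one]

/-- This gives maximality of the sets built from one pair per four-cycle: a third vertex always
completes a path. -/
lemma exists_path_insert : ∀ s : Finset (Fin 4), #s = 2 → ∀ z ∉ s,
    ∃ a ∈ insert z s, ∃ b ∈ insert z s, ∃ c ∈ insert z s,
      (cycleGraph 4).Adj a b ∧ (cycleGraph 4).Adj a c ∧ b ≠ c := by
  simp only [cycleGraph_adj]
  decide

/-- Choosing two vertices in every four-cycle gives a maximal dissociation set. -/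
lemma pow_le_card_maxDissocIn {k : ℕ} (φ : G ≃g copies k (cycleGraph 4)) :
    6 ^ k ≤ #(G.maxDissocIn univ) := by
  have hcard : #(Fintype.piFinset fun _ : Fin k => powersetCard 2 (univ : Finset (Fin 4))) =
      6 ^ k := by
    simp [Fintype.card_piFinset, Nat.choose]
  rw [← hcard]
  refine card_le_card_of_injOn
    (fun g => univ.filter fun x => (φ x).2 ∈ g (φ x).1) ?_ ?_
  · intro g hg
    have hg : ∀ i, #(g i) = 2 := by simpa using hg
    have hφ : ∀ {a b}, G.Adj a b → (φ a).1 = (φ b).1 ∧ (cycleGraph 4).Adj (φ a).2 (φ b).2 :=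
      fun h => φ.map_rel_iff.2 h
    refine mem_maxDissocIn.2 ⟨subset_univ _, ?_, ?_⟩
    · intro a ha b hb c hc hab hac
      simp only [mem_filter, mem_univ, true_and] at ha hb hc
      obtain ⟨h1, h2⟩ := hφ hab
      obtain ⟨h3, h4⟩ := hφ hac
      rw [← h1] at hb
      rw [← h3] at hc
      refine φ.injective (Prod.ext (h1.symm.trans h3) ?_)
      by_contra hbc
      have h5 : #({(φ a).2, (φ b).2, (φ c).2} : Finset (Fin 4)) = 3 :=
        card_eq_three.2 ⟨_, _, _, h2.ne, h4.ne, hbc, rfl⟩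
      have h6 : ({(φ a).2, (φ b).2, (φ c).2} : Finset (Fin 4)) ⊆ g (φ a).1 := by
        simp [insert_subset_iff, ha, hb, hc]
      have := card_le_card h6
      have := hg (φ a).1
      omega
    · intro x _ hx hd
      simp only [mem_filter, mem_univ, true_and] at hx
      obtain ⟨a, ha, b, hb, c, hc, hab, hac, hbc⟩ := exists_path_insert _ (hg (φ x).1) _ hx
      have hmem : ∀ z ∈ insert (φ x).2 (g (φ x).1), φ.symm ((φ x).1, z) ∈
          insert x (univ.filter fun x => (φ x).2 ∈ g (φ x).1) := by
        intro z hz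
        rcases mem_insert.1 hz with rfl | hz
        · simp
        · simp [hz]
      have hadj : ∀ y z, (cycleGraph 4).Adj y z →
          G.Adj (φ.symm ((φ x).1, y)) (φ.symm ((φ x).1, z)) :=
        fun y z h => φ.symm.map_rel_iff.2 ⟨rfl, h⟩
      have := hd _ (hmem a ha) _ (hmem b hb) _ (hmem c hc) (hadj a b hab) (hadj a c hac)
      exact hbc (by simpa using this)
  · intro g _ g' _ h
    funext i
    ext z
    have := congrArg (fun s => φ.symm (i, z) ∈ s) h
    simpa using this

lemma IsFourCycleUnion.exists_iso (h : G.IsFourCycleUnion univ) :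
    ∃ k, Fintype.card V = k * 4 ∧ Nonempty (G ≃g copies k (cycleGraph 4)) := by
  obtain ⟨k, e, he, himg, hadj⟩ := h
  have hsurj : Function.Surjective e := fun a => by
    have : a ∈ univ.image e := himg ▸ mem_univ a
    simpa using this
  let E := Equiv.ofBijective e ⟨he, hsurj⟩
  refine ⟨k, by simpa using (Fintype.card_congr E).symm, ⟨Iso.symm ⟨E, ?_⟩⟩⟩
  exact fun {p q} => hadj p q

lemma IsBipartite.triangleFree (hG : G.IsBipartite) : G.TriangleFree := by
  obtain ⟨c⟩ := hG
  intro a b d hab hbd had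
  have h1 := c.valid hab
  have h2 := c.valid hbd
  have h3 := c.valid had
  omega

end SimpleGraph

open SimpleGraph in
theorem corollary1p1 {V : Type*} [Fintype V] (G : SimpleGraph V) (n : ℕ)
    (hn : Fintype.card V = n) (hG : G.IsBipartite) :
    (G.numMaximalDissociationSets : ℝ) ≤ (6 : ℝ) ^ ((n : ℝ) / 4) ∧
      ((G.numMaximalDissociationSets : ℝ) = (6 : ℝ) ^ ((n : ℝ) / 4) ↔
        n ≡ 0 [MOD 4] ∧
          Nonempty (G ≃g SimpleGraph.copies (n / 4) (SimpleGraph.cycleGraph 4))) := by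
  classical
  subst hn
  have htf := hG.triangleFree
  have hle : (G.numMaximalDissociationSets : ℝ) ≤ (6 : ℝ) ^ ((Fintype.card V : ℝ) / 4) := by
    rw [numMaximalDissociationSets_eq_dissocRatio_mul]
    exact mul_le_of_le_one_left (by positivity) (htf.dissocRatio_le_one _)
  refine ⟨hle, fun h => ?_, fun ⟨hmod, ⟨φ⟩⟩ => le_antisymm hle ?_⟩
  · rw [numMaximalDissociationSets_eq_dissocRatio_mul] at h
    have h1 := (mul_eq_right₀ (by positivity)).1 h
    obtain ⟨k, hk, hiso⟩ := (htf.isFourCycleUnion_of_one_le _ h1.ge).exists_iso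
    rw [hk, Nat.mul_div_cancel _ (by norm_num)]
    exact ⟨Nat.modEq_zero_iff_dvd.2 ⟨k, mul_comm _ _⟩, hiso⟩
  · obtain ⟨k, hk⟩ := Nat.modEq_zero_iff_dvd.1 hmod
    have h1 := pow_le_card_maxDissocIn φ
    rw [← numMaximalDissociationSets_eq_card, hk, Nat.mul_div_cancel_left _ (by norm_num)] at h1
    have h2 : ((4 * k : ℕ) : ℝ) / 4 = (k : ℕ) := by push_cast; ring
    rw [hk, h2, Real.rpow_natCast]
    exact_mod_cast h1
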